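/- Let $\mathbb{F}$ be a field and let $X$ be a finite abstract simplicial complex of dimension $d \ge 0$ with vertex set $V(X)$, $m = \#V(X)$. For a set $A$ let $X[A] = \{\alpha \in X : \alpha \subseteq A\}$ be the induced subcomplex of $X$ on $A$, and for a vertex $x$ let $\mathrm{lk}_X(x) = \{\alpha \in X : x \notin \alpha,\ \alpha \cup \{x\} \in X\}$ be its link. (The empty set is a face of every complex; the trivial complex, whose only face is the empty set, is written $\emptyset$.) Homology is simplicial homology with coefficients in $\mathbb{F}$. Put $\beta_i(X;\mathbb{F}) = \dim_{\mathbb{F}} H_i(X;\mathbb{F})$, and let the reduced Betti numbers be $\widetilde\beta_0 = \beta_0 - 1$ and $\widetilde\beta_i = \beta_i$ for $i \ne 0$; in particular $\widetilde\beta_0(\emptyset) = -1$ and $\widetilde\beta_i(\emptyset) = 0$ for $i \neq 0$. For a complex $L$ with $n$ vertices and $i \ge 0$ put $$\sigma_i(L;\mathbb{F}) = \sum_{j=0}^{n} \frac{1}{\binom{n}{j}} \sum_{A \subseteq V(L),\ \#A = j} \widetilde\beta_i(L[A];\mathbb{F}),$$ and define $\mu_0(X;\mathbb{F}) = 1$ and,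 for $1 \le i \le d$, $$\mu_i(X;\mathbb{F}) = \delta_{i1} + \frac{1}{m} \sum_{x \in V(X)} \sigma_{i-1}(\mathrm{lk}_X(x);\mathbb{F}),$$ where $\delta_{i1}$ is the Kronecker delta. The complex $X$ is called $2$-neighbourly if any two distinct vertices of $X$ form a face of $X$. It is called $\mathbb{F}$-tight if $X$ is connected and, for every induced subcomplex $Y$ of $X$ and every $0 \le j \le d$, the map $H_j(Y;\mathbb{F}) \to H_j(X;\mathbb{F})$ induced by the inclusion $Y \hookrightarrow X$ is injective. Theorem. $X$ is $\mathbb{F}$-tight if and only if $X$ is $2$-neighbourly and $\mu_i(X;\mathbb{F}) = \beta_i(X;\mathbb{F})$ for all $0 \le i \le d$. -/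

import Mathlib

namespace SimplicialTightness

/-! Finite abstract simplicial complexes are modelled by Mathlib's `PreAbstractSimplicialComplex V`
with `V` a finite type. Its faces are the nonempty faces of the complex (the empty face is present
by convention and not recorded), and not every element of `V` has to be a vertex; in particular
`⊥` is the trivial complex whose only face is the empty set. -/

section Complexes

variable {V : Type*}

/-- The induced subcomplex `X[A]` of `X` on `A`: the faces of `X` contained in `A`. -/
def induced (X : PreAbstractSimplicialComplex V) (A : Finset V) :
    PreAbstractSimplicialComplex V where
  faces := {s | s ∈ X ∧ s ⊆ A}
  isRelLowerSet_faces := fun _ hs =>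
    ⟨(X.isRelLowerSet_faces hs.1).1, fun _ hts ht =>
      ⟨(X.isRelLowerSet_faces hs.1).2 hts ht, Finset.Subset.trans hts hs.2⟩⟩

theorem induced_le (X : PreAbstractSimplicialComplex V) (A : Finset V) : induced X A ≤ X :=
  fun _ hs => hs.1

/-- The link of `x` in `X`: the faces `s` of `X` with `x ∉ s` and `s ∪ {x}` a face of `X`. -/
def link [DecidableEq V] (X : PreAbstractSimplicialComplex V) (x : V) :
    PreAbstractSimplicialComplex V where
  faces := {s | s ∈ X ∧ x ∉ s ∧ insert x s ∈ X}
  isRelLowerSet_faces := fun _ hs =>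
    ⟨(X.isRelLowerSet_faces hs.1).1, fun _ hts ht =>
      ⟨(X.isRelLowerSet_faces hs.1).2 hts ht, fun hx => hs.2.1 (hts hx),
        (X.isRelLowerSet_faces hs.2.2).2 (Finset.insert_subset_insert x hts)
          (Finset.insert_nonempty x _)⟩⟩

open Classical in
/-- The vertex set `V(X)`. -/
noncomputable def vertices [Fintype V] (X : PreAbstractSimplicialComplex V) : Finset V :=
  Finset.univ.filter fun v => ({v} : Finset V) ∈ X

/-- `X` has dimension `d`: the largest faces have exactly `d + 1` vertices. -/
def HasDimension (X : PreAbstractSimplicialComplex V) (d : ℕ) : Prop :=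
  (∃ s ∈ X, s.card = d + 1) ∧ ∀ s ∈ X, s.card ≤ d + 1

/-- `X` is `l`-neighbourly: any `l` (distinct) vertices of `X` form a face of `X`. -/
def IsNeighbourly [Fintype V] (X : PreAbstractSimplicialComplex V) (l : ℕ) : Prop :=
  ∀ A : Finset V, A ⊆ vertices X → A.card = l → A.Nonempty → A ∈ X

/-- The graph formed by the vertices and edges of `X`. -/
def edgeGraph [DecidableEq V] (X : PreAbstractSimplicialComplex V) :
    SimpleGraph {v : V // ({v} : Finset V) ∈ X} where
  Adj u v := u ≠ v ∧ ({u.1, v.1} : Finset V) ∈ X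
  symm := ⟨fun u v h => ⟨h.1.symm, by rw [Finset.pair_comm]; exact h.2⟩⟩
  loopless := ⟨fun _ h => h.1 rfl⟩

/-- `X` is connected: it is nonempty and any two vertices are joined by a path of edges. -/
def IsConnected [DecidableEq V] (X : PreAbstractSimplicialComplex V) : Prop :=
  (edgeGraph X).Connected

end Complexes

section Homology

variable (F : Type*) [Field F] {V : Type*}

/-- The simplicial `k`-chains of `X` with coefficients in `F`: a chain `∑ c_s s` over the
`k`-dimensional faces `s` of `X` is recorded as its coefficient function `c`, extended by `0` to all
finite subsets of `V`. -/
def chains (X : PreAbstractSimplicialComplex V) (k : ℕ) : Submodule F (Finset V → F) where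
  carrier := {c | ∀ s, ¬ (s ∈ X ∧ s.card = k + 1) → c s = 0}
  add_mem' := fun ha hb s hs => by rw [Pi.add_apply, ha s hs, hb s hs, add_zero]
  zero_mem' := fun _ _ => rfl
  smul_mem' := fun r c hc s hs => by rw [Pi.smul_apply, hc s hs, smul_zero]

theorem chains_mono {Y X : PreAbstractSimplicialComplex V} (h : Y ≤ X) (k : ℕ) :
    chains F Y k ≤ chains F X k :=
  fun _ hc s hs => hc s fun hY => hs ⟨h hY.1, hY.2⟩

variable [Fintype V] [LinearOrder V]

/-- The simplicial boundary operator: a simplex `s` (oriented by the order of `V`) with at least two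
vertices is sent to `∑ (-1)^p • (s without its p-th vertex)`, the vertices of `s` being numbered in
increasing order from `p = 0`; a `0`-simplex is sent to `0`. Here the simplex `s`, as a chain, is
`Pi.single s 1`. -/
noncomputable def boundary : (Finset V → F) →ₗ[F] (Finset V → F) :=
  Fintype.linearCombination F fun s : Finset V =>
    if 2 ≤ s.card then
      ∑ v ∈ s, (-1 : F) ^ (s.filter (· < v)).card • (Pi.single (s.erase v) 1 : Finset V → F)
    else 0

/-- The simplicial `k`-cycles of `X`. -/
noncomputable def cycles (X : PreAbstractSimplicialComplex V) (k : ℕ) :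
    Submodule F (Finset V → F) :=
  chains F X k ⊓ LinearMap.ker (boundary F)

/-- The simplicial `k`-boundaries of `X`. -/
noncomputable def boundaries (X : PreAbstractSimplicialComplex V) (k : ℕ) :
    Submodule F (Finset V → F) :=
  (chains F X (k + 1)).map (boundary F)

/-- The simplicial homology `H_k(X; F)`: cycles modulo boundaries. -/
abbrev Homology (X : PreAbstractSimplicialComplex V) (k : ℕ) : Type _ :=
  cycles F X k ⧸ (boundaries F X k).submoduleOf (cycles F X k)

theorem cycles_mono {Y X : PreAbstractSimplicialComplex V} (h : Y ≤ X) (k : ℕ) :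
    cycles F Y k ≤ cycles F X k :=
  inf_le_inf_right _ (chains_mono F h k)

theorem boundaries_mono {Y X : PreAbstractSimplicialComplex V} (h : Y ≤ X) (k : ℕ) :
    boundaries F Y k ≤ boundaries F X k :=
  Submodule.map_mono (chains_mono F h (k + 1))

/-- The map `H_k(Y; F) → H_k(X; F)` induced by the inclusion of a subcomplex `Y` of `X`. -/
noncomputable def homologyMap {Y X : PreAbstractSimplicialComplex V} (h : Y ≤ X) (k : ℕ) :
    Homology F Y k →ₗ[F] Homology F X k :=
  Submodule.mapQ _ _ (Submodule.inclusion (cycles_mono F h k))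
    fun _ hz => boundaries_mono F h k hz

/-- The Betti number `β_k(X; F) = dim_F H_k(X; F)`. -/
noncomputable def betti (X : PreAbstractSimplicialComplex V) (k : ℕ) : ℕ :=
  Module.finrank F (Homology F X k)

/-- The reduced Betti number: `β_0 - 1` for `k = 0` (so `-1` for the trivial complex), and `β_k`
for `k ≠ 0`. -/
noncomputable def reducedBetti (X : PreAbstractSimplicialComplex V) (k : ℕ) : ℤ :=
  if k = 0 then (betti F X k : ℤ) - 1 else betti F X k

/-- The sigma-vector: with `m` the number of vertices of `X`,
`σ_i(X) = ∑_{j=0}^m (1 / (m choose j)) ∑_{A ⊆ V(X), #A = j} β̃_i(X[A])`. -/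
noncomputable def sigma (X : PreAbstractSimplicialComplex V) (i : ℕ) : ℚ :=
  ∑ j ∈ Finset.range ((vertices X).card + 1),
    (1 / ((vertices X).card.choose j : ℚ)) *
      ∑ A ∈ (vertices X).powersetCard j, (reducedBetti F (induced X A) i : ℚ)

/-- The mu-vector: `μ_0(X) = 1`, and with `m` the number of vertices of `X`,
`μ_i(X) = δ_{i1} + (1 / m) ∑_{x ∈ V(X)} σ_{i-1}(lk_X(x))` for `i ≥ 1`. -/
noncomputable def mu (X : PreAbstractSimplicialComplex V) : ℕ → ℚ
  | 0 => 1
  | i + 1 => (if i + 1 = 1 then 1 else 0) +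
      (1 / ((vertices X).card : ℚ)) * ∑ x ∈ vertices X, sigma F (link X x) i

/-- A complex `X` of dimension `d` is `F`-tight: it is connected and, for every induced subcomplex
`Y` of `X` and every `0 ≤ j ≤ d`, the map `H_j(Y; F) → H_j(X; F)` is injective. -/
def IsTight (X : PreAbstractSimplicialComplex V) (d : ℕ) : Prop :=
  IsConnected X ∧ ∀ A : Finset V, ∀ j ≤ d,
    Function.Injective (homologyMap F (induced_le X A) j)

end Homology

end SimplicialTightness

/-! Build `X` by adding its vertices one at a time in some order, each with all faces it forms with
its predecessors. Passing from `X[A]` to `X[A ∪ {x}]`, the relative chains are the augmented chains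
of the part of the link of `x` on `A`, shifted by one degree. The long exact sequence of the pair
then writes the jump of `β_k` as the relative Betti number minus a defect: the dimensions of the
kernels of `X[A] → X[A ∪ {x}]` on `H_k` and `H_{k-1}` (`betti_insert_sub_betti`).

Averaged over all orderings, the jumps telescope to `β_k(X)`. When `X` is 2-neighbourly, every other
vertex lies in the link of `x`, and the relative Betti numbers average to `μ_k`. So `μ_k - β_k` is
an average of nonnegative defects (`mu_sub_betti`), each with positive weight, and it vanishes
exactly when all of them do. Vanishing kernels for one-vertex steps compose to injectivity into `X`
(`homologyMap_injective_of_kernelDim`).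

That tightness forces 2-neighbourliness is a statement about `H_0`: two nonadjacent vertices would
be homologous in the connected complex but not in the subcomplex they induce
(`IsTight.isNeighbourly`). -/

namespace SimplicialTightness

/-! ### The boundary operator as a sum of anticommuting vertex deletions. -/

section Contraction

variable (F : Type*) [Field F] {V : Type*} [LinearOrder V]

/-- The sign with which `v` is deleted from `insert v s`. -/
def deletionSign (s : Finset V) (v : V) : F := (-1) ^ (s.filter (· < v)).card

theorem deletionSign_mul_self (s : Finset V) (v : V) :
    deletionSign F s v * deletionSign F s v = 1 := by
  simp [deletionSign, ← mul_pow]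

theorem deletionSign_insert {s : Finset V} {u : V} (hu : u ∉ s) (v : V) :
    deletionSign F (insert u s) v = (if u < v then -1 else 1) * deletionSign F s v := by
  unfold deletionSign
  rw [Finset.filter_insert]
  split_ifs with h
  · rw [Finset.card_insert_of_notMem (by simp [hu]), pow_succ']
  · rw [one_mul]

/-- Contraction of chains by the vertex `v`: the part of the boundary operator deleting `v`. -/
def contraction (v : V) : (Finset V → F) →ₗ[F] (Finset V → F) where
  toFun c s := if v ∈ s then 0 else deletionSign F s v * c (insert v s)
  map_add' a b := by
    ext s
    simp only [Pi.add_apply]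
    split_ifs
    · simp
    · ring
  map_smul' r a := by
    ext s
    simp only [Pi.smul_apply, smul_eq_mul, RingHom.id_apply]
    split_ifs
    · simp
    · ring

variable {F}

theorem contraction_apply (v : V) (c : Finset V → F) (s : Finset V) :
    contraction F v c s = if v ∈ s then 0 else deletionSign F s v * c (insert v s) := rfl

theorem contraction_contraction_self (v : V) (c : Finset V → F) :
    contraction F v (contraction F v c) = 0 := by
  ext s
  simp [contraction_apply]

/-- Both orders delete the same two vertices; only the sign of the larger one notices whether the
smaller is still present, which costs one factor `-1`. -/
theorem contraction_anticomm (u v : V) (c : Finset V → F) :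
    contraction F u (contraction F v c) = -contraction F v (contraction F u c) := by
  rcases eq_or_ne u v with rfl | huv
  · simp [contraction_contraction_self]
  ext s
  simp only [Pi.neg_apply, contraction_apply, Finset.mem_insert, huv, huv.symm, false_or]
  by_cases hu : u ∈ s
  · simp [hu]
  by_cases hv : v ∈ s
  · simp [hv]
  simp only [hu, hv, if_false, deletionSign_insert F hu, deletionSign_insert F hv,
    Finset.insert_comm u v s]
  rcases lt_or_gt_of_ne huv with h | h
  · simp only [h, h.not_gt, if_true, if_false]
    ring
  · simp only [h, h.not_gt, if_true, if_false]
    ring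

theorem contraction_single (v : V) (s : Finset V) :
    contraction F v (Pi.single s 1) =
      if v ∈ s then deletionSign F s v • (Pi.single (s.erase v) 1 : Finset V → F) else 0 := by
  ext t
  rw [contraction_apply]
  by_cases hv : v ∈ s
  · rw [if_pos hv]
    by_cases ht : v ∈ t
    · have : t ≠ s.erase v := fun h => by simp [h] at ht
      simp [ht, this]
    · by_cases h : t = s.erase v
      · subst h
        have : (s.erase v).filter (· < v) = s.filter (· < v) := by
          ext w
          simp only [Finset.mem_filter, Finset.mem_erase]
          exact ⟨fun h => ⟨h.1.2, h.2⟩, fun h => ⟨⟨h.2.ne, h.1⟩, h.2⟩⟩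
        simp [Finset.insert_erase hv, deletionSign, this]
      · have : insert v t ≠ s := fun h' => h (by rw [← h', Finset.erase_insert ht])
        simp [ht, this, h]
  · have : insert v t ≠ s := fun h => hv (h ▸ Finset.mem_insert_self v t)
    simp [hv, this]

theorem contraction_mem_chains {X : PreAbstractSimplicialComplex V} {k : ℕ} (v : V)
    {c : Finset V → F} (hc : c ∈ chains F X (k + 1)) : contraction F v c ∈ chains F X k := by
  intro s hs
  rw [contraction_apply]
  split_ifs with hv
  · rfl
  · rw [hc, mul_zero]
    rintro ⟨h, hcard⟩
    rw [Finset.card_insert_of_notMem hv] at hcard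
    have hcard : s.card = k + 1 := by lia
    exact hs ⟨(X.isRelLowerSet_faces h).2 (Finset.subset_insert v s)
      (Finset.card_pos.mp (by lia)), hcard⟩

variable [Fintype V]

variable (F V) in
/-- The boundary operator of the augmented chain complex: a vertex is sent to the empty face. -/
def augmentedBoundary : (Finset V → F) →ₗ[F] (Finset V → F) := ∑ v : V, contraction F v

theorem augmentedBoundary_apply (c : Finset V → F) :
    augmentedBoundary F V c = ∑ v : V, contraction F v c := by
  simp [augmentedBoundary]

theorem contraction_augmentedBoundary (v : V) (c : Finset V → F) :
    contraction F v (augmentedBoundary F V c) = -augmentedBoundary F V (contraction F v c) := by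
  simp only [augmentedBoundary_apply, map_sum, ← Finset.sum_neg_distrib]
  exact Finset.sum_congr rfl fun u _ => contraction_anticomm v u c

theorem augmentedBoundary_augmentedBoundary (c : Finset V → F) :
    augmentedBoundary F V (augmentedBoundary F V c) = 0 := by
  simp only [augmentedBoundary_apply, map_sum]
  rw [← Finset.sum_product']
  -- Swapped pairs cancel, and the fixed points of the swap are squares of contractions, which
  -- vanish.
  refine Finset.sum_involution (fun p _ => p.swap) (fun p _ => ?_) (fun p _ hp h => hp ?_)
    (fun _ _ => Finset.mem_univ _) fun _ _ => rfl
  · dsimp only [Prod.fst_swap, Prod.snd_swap]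
    rw [contraction_anticomm p.1 p.2, add_neg_cancel]
  · have : p.1 = p.2 := (congrArg Prod.snd h)
    rw [this, contraction_contraction_self]

/-- The two operators differ only on vertices, where one gives zero and the other the empty face;
hence the restriction to positive degree. -/
theorem boundary_eq_augmentedBoundary {X : PreAbstractSimplicialComplex V} {k : ℕ}
    {c : Finset V → F} (hc : c ∈ chains F X (k + 1)) :
    boundary F c = augmentedBoundary F V c := by
  have hsum : c = ∑ s, c s • (Pi.single s 1 : Finset V → F) := by
    ext t
    simp [Finset.sum_apply, Pi.single_apply]
  conv_rhs => rw [hsum, map_sum]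
  rw [boundary, Fintype.linearCombination_apply]
  refine Finset.sum_congr rfl fun s _ => ?_
  rw [map_smul]
  by_cases hs : s ∈ X ∧ s.card = k + 1 + 1
  · rw [if_pos (by lia), augmentedBoundary_apply]
    simp only [contraction_single, Finset.sum_ite_mem, Finset.univ_inter]
    rfl
  · rw [hc s hs, zero_smul, zero_smul]

theorem boundary_eq_zero {X : PreAbstractSimplicialComplex V} {c : Finset V → F}
    (hc : c ∈ chains F X 0) : boundary F c = 0 := by
  rw [boundary, Fintype.linearCombination_apply]
  refine Finset.sum_eq_zero fun s _ => ?_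
  by_cases hs : s ∈ X ∧ s.card = 0 + 1
  · rw [if_neg (by lia), smul_zero]
  · rw [hc s hs, zero_smul]

theorem boundary_mem_chains {X : PreAbstractSimplicialComplex V} {k : ℕ}
    {c : Finset V → F} (hc : c ∈ chains F X (k + 1)) : boundary F c ∈ chains F X k := by
  rw [boundary_eq_augmentedBoundary hc, augmentedBoundary_apply]
  exact Submodule.sum_mem _ fun v _ => contraction_mem_chains v hc

theorem boundaries_le_chains (X : PreAbstractSimplicialComplex V) (k : ℕ) :
    boundaries F X k ≤ chains F X k := by
  rintro _ ⟨c, hc, rfl⟩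
  exact boundary_mem_chains hc

theorem boundaries_le_cycles (X : PreAbstractSimplicialComplex V) (k : ℕ) :
    boundaries F X k ≤ cycles F X k := by
  refine le_inf (boundaries_le_chains X k) ?_
  rintro _ ⟨c, hc, rfl⟩
  rw [LinearMap.mem_ker]
  cases k with
  | zero => exact boundary_eq_zero (boundary_mem_chains hc)
  | succ k =>
    rw [boundary_eq_augmentedBoundary (boundary_mem_chains hc), boundary_eq_augmentedBoundary hc,
      augmentedBoundary_augmentedBoundary]

end Contraction

/-! ### The exact sequence relating chains of `X[A]`, of `X[A ∪ {x}]` and of the link of `x`. -/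

section InducedChains

variable {F : Type*} [Field F] {V : Type*} {X : PreAbstractSimplicialComplex V} {A : Finset V}

theorem induced_mono (X : PreAbstractSimplicialComplex V) {A B : Finset V} (h : A ⊆ B) :
    induced X A ≤ induced X B :=
  fun _ hs => ⟨hs.1, hs.2.trans h⟩

theorem chains_induced_empty (k : ℕ) : chains F (induced X ∅) k = ⊥ := by
  rw [eq_bot_iff]
  intro c hc
  rw [Submodule.mem_bot]
  ext s
  refine hc s fun h => ?_
  rw [Finset.subset_empty.mp h.1.2] at h
  simp at h

variable [LinearOrder V] {x : V}

theorem map_contraction_chains (k : ℕ) :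
    (chains F (induced X (insert x A)) (k + 1)).map (contraction F x) =
      chains F (induced (link X x) A) k := by
  apply le_antisymm
  · rintro _ ⟨c, hc, rfl⟩ s hs
    rw [contraction_apply]
    split_ifs with hxs
    · rfl
    · rw [hc, mul_zero]
      rintro ⟨⟨h, hsub⟩, hcard⟩
      rw [Finset.card_insert_of_notMem hxs] at hcard
      have hcard : s.card = k + 1 := by lia
      refine hs ⟨⟨⟨(X.isRelLowerSet_faces h).2 (Finset.subset_insert x s)
        (Finset.card_pos.mp (by lia)), hxs, h⟩, ?_⟩, hcard⟩
      exact (Finset.insert_subset_insert_iff hxs).mp hsub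
  · intro c hc
    -- The preimage is the cone over `c` with apex `x`; its sign cancels because signs square to
    -- one.
    refine ⟨fun s => if x ∈ s then deletionSign F (s.erase x) x * c (s.erase x) else 0, ?_, ?_⟩
    · intro s hs
      dsimp only
      split_ifs with hxs
      · rw [hc, mul_zero]
        rintro ⟨⟨⟨-, -, h⟩, hsub⟩, hcard⟩
        rw [Finset.insert_erase hxs] at h
        refine hs ⟨⟨h, ?_⟩, ?_⟩
        · rw [← Finset.insert_erase hxs]
          exact Finset.insert_subset_insert x hsub
        · rw [← Finset.insert_erase hxs, Finset.card_insert_of_notMem (by simp), hcard]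
      · rfl
    · ext s
      rw [contraction_apply]
      by_cases hxs : x ∈ s
      · rw [if_pos hxs]
        exact (hc s fun h => h.1.1.2.1 hxs).symm
      · rw [if_neg hxs, if_pos (Finset.mem_insert_self x s), Finset.erase_insert hxs, ← mul_assoc,
          deletionSign_mul_self, one_mul]

/-- Contraction by `x` reads off, up to sign, exactly the coefficients on faces containing `x`. -/
theorem chains_inf_ker_contraction (hx : x ∉ A) (k : ℕ) :
    chains F (induced X (insert x A)) k ⊓ LinearMap.ker (contraction F x) =
      chains F (induced X A) k := by
  apply le_antisymm
  · rintro c ⟨hc, hker⟩ s hs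
    by_cases hxs : x ∈ s
    · have h := congrFun (LinearMap.mem_ker.mp hker) (s.erase x)
      rw [contraction_apply, if_neg (by simp), Finset.insert_erase hxs] at h
      rw [← one_mul (c s), ← deletionSign_mul_self F (s.erase x) x, mul_assoc, h]
      simp
    · refine hc s fun h => hs ⟨⟨h.1.1, ?_⟩, h.2⟩
      exact (Finset.subset_insert_iff_of_notMem hxs).mp h.1.2
  · intro c hc
    refine ⟨fun s hs => hc s fun h => hs
      ⟨⟨h.1.1, h.1.2.trans (Finset.subset_insert x A)⟩, h.2⟩, LinearMap.mem_ker.mpr ?_⟩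
    ext s
    rw [contraction_apply]
    split_ifs with hxs
    · rfl
    · rw [hc, mul_zero]
      · rfl
      · exact fun h => hx (h.1.2 (Finset.mem_insert_self x s))

end InducedChains

/-! ### Dimension counts for adding one vertex. -/

section Dimension

open Module

variable {F : Type*} [Field F] {V : Type*} [Fintype V] [LinearOrder V]

theorem finrank_eq_finrank_map_add {E : Type*} [AddCommGroup E] [Module F E]
    [FiniteDimensional F E] (p : Submodule F E) (f : E →ₗ[F] E) :
    finrank F p = finrank F (p.map f) + finrank F (p ⊓ LinearMap.ker f : Submodule F E) := by
  rw [← LinearMap.finrank_range_add_finrank_ker (f.domRestrict p), LinearMap.range_domRestrict,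
    LinearMap.ker_domRestrict,
    ← Submodule.map_comap_subtype, Submodule.finrank_map_subtype_eq]

theorem betti_add_finrank_boundaries (X : PreAbstractSimplicialComplex V) (k : ℕ) :
    betti F X k + finrank F (boundaries F X k) = finrank F (cycles F X k) := by
  rw [← Submodule.finrank_quotient_add_finrank ((boundaries F X k).submoduleOf (cycles F X k)),
    (Submodule.submoduleOfEquivOfLe (boundaries_le_cycles X k)).finrank_eq]
  rfl

theorem betti_zero_add (X : PreAbstractSimplicialComplex V) :
    betti F X 0 + finrank F (boundaries F X 0) = finrank F (chains F X 0) := by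
  rw [betti_add_finrank_boundaries, cycles, inf_eq_left.mpr fun c hc => boundary_eq_zero hc]

theorem betti_succ_add (X : PreAbstractSimplicialComplex V) (k : ℕ) :
    betti F X (k + 1) + finrank F (boundaries F X (k + 1)) + finrank F (boundaries F X k) =
      finrank F (chains F X (k + 1)) := by
  rw [betti_add_finrank_boundaries, finrank_eq_finrank_map_add (chains F X (k + 1)) (boundary F),
    add_comm]
  rfl

variable {X : PreAbstractSimplicialComplex V} {x : V} {A : Finset V}

/-- Contraction anticommutes with the augmented boundary, so boundaries map to augmented boundaries
of link chains. For `k = 0` these lie in the span of the empty face, whence the reduced Betti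
numbers of the link. -/
theorem map_contraction_boundaries (k : ℕ) :
    (boundaries F (induced X (insert x A)) k).map (contraction F x) =
      (chains F (induced (link X x) A) k).map (augmentedBoundary F V) := by
  rw [← map_contraction_chains, boundaries]
  ext z
  simp only [Submodule.mem_map, exists_exists_and_eq_and]
  constructor
  · rintro ⟨c, hc, rfl⟩
    refine ⟨-c, neg_mem hc, ?_⟩
    rw [boundary_eq_augmentedBoundary hc, contraction_augmentedBoundary, map_neg, map_neg]
  · rintro ⟨c, hc, rfl⟩
    refine ⟨-c, neg_mem hc, ?_⟩
    rw [boundary_eq_augmentedBoundary (neg_mem hc), contraction_augmentedBoundary, map_neg, map_neg,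
      neg_neg]

theorem boundaries_inf_ker_contraction (hx : x ∉ A) (k : ℕ) :
    boundaries F (induced X (insert x A)) k ⊓ LinearMap.ker (contraction F x) =
      boundaries F (induced X (insert x A)) k ⊓ chains F (induced X A) k := by
  rw [← chains_inf_ker_contraction hx, ← inf_assoc,
    inf_eq_left.mpr (boundaries_le_chains (induced X (insert x A)) k)]

theorem finrank_chains_succ (hx : x ∉ A) (k : ℕ) :
    finrank F (chains F (induced X (insert x A)) (k + 1)) =
      finrank F (chains F (induced (link X x) A) k) +
        finrank F (chains F (induced X A) (k + 1)) := by
  rw [finrank_eq_finrank_map_add _ (contraction F x), map_contraction_chains,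
    chains_inf_ker_contraction hx]

theorem finrank_chains_zero (hX : {x} ∈ X) (hx : x ∉ A) :
    finrank F (chains F (induced X (insert x A)) 0) =
      1 + finrank F (chains F (induced X A) 0) := by
  rw [finrank_eq_finrank_map_add _ (contraction F x), chains_inf_ker_contraction hx]
  suffices h : (chains F (induced X (insert x A)) 0).map (contraction F x) =
      Submodule.span F {Pi.single ∅ 1} by rw [h, finrank_span_singleton (Pi.single_ne_zero_iff.mpr one_ne_zero)]
  apply le_antisymm
  · rintro _ ⟨c, hc, rfl⟩
    refine Submodule.mem_span_singleton.mpr ⟨contraction F x c ∅, ?_⟩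
    ext s
    rcases s.eq_empty_or_nonempty with rfl | hs
    · simp
    · rw [contraction_apply, contraction_apply]
      by_cases h1 : x ∈ s
      · simp [hs.ne_empty, h1]
      · rw [hc (insert x s)]
        · simp [hs.ne_empty]
        · intro h
          rw [Finset.card_insert_of_notMem h1] at h
          exact hs.card_pos.ne' (by lia)
  · rw [Submodule.span_singleton_le_iff_mem]
    refine ⟨Pi.single {x} 1, ?_, ?_⟩
    · intro s hs
      refine Pi.single_eq_of_ne (fun h => hs ?_) _
      subst h
      exact ⟨⟨hX, by simp⟩, by simp⟩
    · rw [contraction_single]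
      simp [deletionSign, Finset.filter_singleton]

theorem finrank_boundaries_succ (hx : x ∉ A) (k : ℕ) :
    finrank F (boundaries F (induced X (insert x A)) (k + 1)) =
      finrank F (boundaries F (induced (link X x) A) k) +
        finrank F (boundaries F (induced X (insert x A)) (k + 1) ⊓
          chains F (induced X A) (k + 1) : Submodule F (Finset V → F)) := by
  rw [finrank_eq_finrank_map_add _ (contraction F x), map_contraction_boundaries,
    boundaries_inf_ker_contraction hx]
  suffices h : (chains F (induced (link X x) A) (k + 1)).map (augmentedBoundary F V) =
      boundaries F (induced (link X x) A) k by rw [h]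
  ext z
  simp only [boundaries, Submodule.mem_map]
  refine exists_congr fun c => and_congr_right fun hc => ?_
  rw [boundary_eq_augmentedBoundary hc]

/-- By `hA` every vertex of `A` lies in the link of `x`, so the augmentation of the link on `A` is
onto unless `A` is empty. -/
theorem finrank_boundaries_zero (hx : x ∉ A)
    (hA : ∀ v ∈ A, {v} ∈ X ∧ {x, v} ∈ X) :
    finrank F (boundaries F (induced X (insert x A)) 0) =
      (if A = ∅ then 0 else 1) +
        finrank F (boundaries F (induced X (insert x A)) 0 ⊓
          chains F (induced X A) 0 : Submodule F (Finset V → F)) := by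
  rw [finrank_eq_finrank_map_add _ (contraction F x), map_contraction_boundaries,
    boundaries_inf_ker_contraction hx]
  congr 1
  split_ifs with h
  · subst h
    rw [chains_induced_empty]
    simp
  · suffices h' : (chains F (induced (link X x) A) 0).map (augmentedBoundary F V) =
        Submodule.span F {Pi.single ∅ 1} by rw [h', finrank_span_singleton (Pi.single_ne_zero_iff.mpr one_ne_zero)]
    apply le_antisymm
    · rintro _ ⟨c, hc, rfl⟩
      refine Submodule.mem_span_singleton.mpr ⟨augmentedBoundary F V c ∅, ?_⟩
      ext s
      rcases s.eq_empty_or_nonempty with rfl | hs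
      · simp
      · rw [augmentedBoundary_apply, Pi.smul_apply, Pi.single_eq_of_ne hs.ne_empty, smul_zero,
          Finset.sum_apply]
        · refine (Finset.sum_eq_zero fun v _ => ?_).symm
          rw [contraction_apply]
          split_ifs with h1
          · rfl
          · rw [hc (insert v s), mul_zero]
            intro h
            rw [Finset.card_insert_of_notMem h1] at h
            exact hs.card_pos.ne' (by lia)
    · obtain ⟨v, hv⟩ := Finset.nonempty_of_ne_empty h
      rw [Submodule.span_singleton_le_iff_mem]
      refine ⟨Pi.single {v} 1, ?_, ?_⟩
      · intro s hs
        refine Pi.single_eq_of_ne (fun h => hs ?_) _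
        subst h
        refine ⟨⟨⟨(hA v hv).1, ?_, (hA v hv).2⟩, by simpa⟩, by simp⟩
        simp only [Finset.mem_singleton]
        rintro rfl
        exact hx hv
      · rw [augmentedBoundary_apply]
        simp [contraction_single, deletionSign, Finset.filter_singleton]

end Dimension


/-! ### Averages over orderings of a finite set. -/

section Averaging

variable {V : Type*} [DecidableEq V]

/-- Double counting: a `j`-subset of `W` is missed by `#W - j` elements. -/
theorem sum_sum_powersetCard_erase (W : Finset V) (j : ℕ) (g : Finset V → ℚ) :
    ∑ x ∈ W, ∑ A ∈ (W.erase x).powersetCard j, g A =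
      ((W.card : ℚ) - j) * ∑ A ∈ W.powersetCard j, g A := by
  rw [Finset.sum_comm' (t' := W.powersetCard j) (s' := fun A => W \ A), Finset.mul_sum]
  · refine Finset.sum_congr rfl fun A hA => ?_
    rw [Finset.mem_powersetCard] at hA
    rw [Finset.sum_const, Finset.card_sdiff_of_subset hA.1, nsmul_eq_mul,
      Nat.cast_sub (Finset.card_le_card hA.1), hA.2]
  · intro x A
    simp only [Finset.mem_powersetCard, Finset.subset_erase, Finset.mem_sdiff]
    tauto

theorem sum_sum_powersetCard_insert (W : Finset V) (j : ℕ) (g : Finset V → ℚ) :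
    ∑ x ∈ W, ∑ A ∈ (W.erase x).powersetCard j, g (insert x A) =
      ((j : ℚ) + 1) * ∑ A ∈ W.powersetCard (j + 1), g A := by
  have h : ∀ x ∈ W, ∑ A ∈ (W.erase x).powersetCard j, g (insert x A) =
      ∑ B ∈ (W.powersetCard (j + 1)).filter (x ∈ ·), g B := by
    intro x hx
    refine Finset.sum_bij' (fun A _ => insert x A) (fun B _ => B.erase x) ?_ ?_ ?_ ?_
      fun _ _ => rfl
    · intro A hA
      simp only [Finset.mem_powersetCard, Finset.subset_erase, Finset.mem_filter] at hA ⊢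
      exact ⟨⟨Finset.insert_subset hx hA.1.1, by rw [Finset.card_insert_of_notMem hA.1.2, hA.2]⟩,
        Finset.mem_insert_self x A⟩
    · intro B hB
      simp only [Finset.mem_powersetCard, Finset.mem_filter] at hB ⊢
      exact ⟨Finset.erase_subset_erase x hB.1.1, by
        rw [Finset.card_erase_of_mem hB.2, hB.1.2, Nat.add_sub_cancel]⟩
    · intro A hA
      simp only [Finset.mem_powersetCard, Finset.subset_erase] at hA
      exact Finset.erase_insert hA.1.2
    · intro B hB
      exact Finset.insert_erase (Finset.mem_filter.mp hB).2
  rw [Finset.sum_congr rfl h,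
    Finset.sum_comm' (t' := W.powersetCard (j + 1)) (s' := fun A => A), Finset.mul_sum]
  · refine Finset.sum_congr rfl fun A hA => ?_
    rw [Finset.sum_const, nsmul_eq_mul, (Finset.mem_powersetCard.mp hA).2]
    push_cast
    rfl
  · intro x A
    simp only [Finset.mem_powersetCard, Finset.mem_filter]
    exact ⟨fun h => ⟨h.2.2, h.2.1⟩, fun h => ⟨h.2.1 h.1, h.2, h.1⟩⟩

/-- The average of `f x A` over the pairs consisting of an element `x` of `W` and the set `A` of its
predecessors in an ordering of `W`, summed over `x`. -/
def shellingAverage (W : Finset V) (f : V → Finset V → ℚ) : ℚ :=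
  ∑ x ∈ W, ∑ j ∈ Finset.range W.card, ∑ A ∈ (W.erase x).powersetCard j,
    1 / ((W.card : ℚ) * ((W.card - 1).choose j : ℚ)) * f x A

theorem shellingAverage_congr {W : Finset V} {f g : V → Finset V → ℚ}
    (h : ∀ x ∈ W, ∀ A ⊆ W.erase x, f x A = g x A) :
    shellingAverage W f = shellingAverage W g :=
  Finset.sum_congr rfl fun x hx => Finset.sum_congr rfl fun _ _ => Finset.sum_congr rfl fun A hA =>
    by rw [h x hx A (Finset.mem_powersetCard.mp hA).1]

theorem shellingAverage_add (W : Finset V) (f g : V → Finset V → ℚ) :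
    shellingAverage W (fun x A => f x A + g x A) = shellingAverage W f + shellingAverage W g := by
  simp only [shellingAverage, mul_add, Finset.sum_add_distrib]

theorem shellingAverage_sub (W : Finset V) (f g : V → Finset V → ℚ) :
    shellingAverage W (fun x A => f x A - g x A) = shellingAverage W f - shellingAverage W g := by
  simp only [shellingAverage, mul_sub, Finset.sum_sub_distrib]

/-- Every pair `(x, A)` occurs in some ordering, so its weight is positive. -/
theorem eq_zero_of_shellingAverage_eq_zero {W : Finset V} {f : V → Finset V → ℚ}
    (hf : ∀ x ∈ W, ∀ A ⊆ W.erase x, 0 ≤ f x A) (h : shellingAverage W f = 0) :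
    ∀ x ∈ W, ∀ A ⊆ W.erase x, f x A = 0 := by
  intro x hx A hA
  have hnonneg : ∀ y ∈ W, ∀ j, ∀ B ∈ (W.erase y).powersetCard j,
      0 ≤ 1 / ((W.card : ℚ) * ((W.card - 1).choose j : ℚ)) * f y B := fun y hy j B hB =>
    mul_nonneg (by positivity) (hf y hy B (Finset.mem_powersetCard.mp hB).1)
  have hcard := Finset.card_le_card hA
  rw [Finset.card_erase_of_mem hx] at hcard
  have hW : 0 < W.card := Finset.card_pos.mpr ⟨x, hx⟩
  have h1 := (Finset.sum_eq_zero_iff_of_nonneg fun y hy =>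
    Finset.sum_nonneg fun j _ => Finset.sum_nonneg (hnonneg y hy j)).mp h x hx
  have h2 := (Finset.sum_eq_zero_iff_of_nonneg fun j _ =>
    Finset.sum_nonneg (hnonneg x hx j)).mp h1 A.card (Finset.mem_range.mpr (by lia))
  have h3 := (Finset.sum_eq_zero_iff_of_nonneg (hnonneg x hx A.card)).mp h2 A
    (Finset.mem_powersetCard.mpr ⟨hA, rfl⟩)
  refine (mul_eq_zero.mp h3).resolve_left ?_
  have := Nat.choose_pos hcard
  positivity

theorem shellingAverage_telescope (W : Finset V) (g : Finset V → ℚ) :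
    shellingAverage W (fun x A => g (insert x A) - g A) = g W - g ∅ := by
  -- Level `j` contributes the mean of `g` over `(j+1)`-subsets minus its mean over `j`-subsets; the
  -- identities `e1` and `e2` turn the weights into those of the means.
  have h : ∀ j ∈ Finset.range W.card, ∑ x ∈ W, ∑ A ∈ (W.erase x).powersetCard j,
      1 / ((W.card : ℚ) * ((W.card - 1).choose j : ℚ)) * (g (insert x A) - g A) =
      1 / (W.card.choose (j + 1) : ℚ) * ∑ A ∈ W.powersetCard (j + 1), g A -
        1 / (W.card.choose j : ℚ) * ∑ A ∈ W.powersetCard j, g A := by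
    intro j hj
    rw [Finset.mem_range] at hj
    simp only [← Finset.mul_sum, Finset.sum_sub_distrib]
    rw [sum_sum_powersetCard_insert, sum_sum_powersetCard_erase, mul_sub, ← mul_assoc, ← mul_assoc]
    obtain ⟨n, hn⟩ : ∃ n, W.card = n + 1 := ⟨W.card - 1, by lia⟩
    rw [hn, Nat.add_sub_cancel]
    have hjn : j ≤ n := by lia
    have e1 : ((n : ℚ) + 1) * (n.choose j : ℚ) = ((n + 1).choose (j + 1) : ℚ) * (j + 1) := by
      exact_mod_cast Nat.add_one_mul_choose_eq n j
    have e2 : ((n.choose j : ℚ)) * (n + 1) = ((n + 1).choose j : ℚ) * (n + 1 - j) := by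
      have := Nat.choose_mul_succ_eq n j
      have h' : ((n + 1 - j : ℕ) : ℚ) = n + 1 - j := by
        rw [Nat.cast_sub (by lia)]
        push_cast
        rfl
      rw [← h']
      exact_mod_cast this
    have p1 : (n.choose j : ℚ) ≠ 0 := by exact_mod_cast (Nat.choose_pos hjn).ne'
    have p2 : ((n + 1).choose (j + 1) : ℚ) ≠ 0 := by
      exact_mod_cast (Nat.choose_pos (by lia)).ne'
    have p3 : ((n + 1).choose j : ℚ) ≠ 0 := by
      exact_mod_cast (Nat.choose_pos (by lia)).ne'
    have p4 : (n : ℚ) + 1 ≠ 0 := by positivity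
    congr 2
    · push_cast
      field_simp
      linear_combination -e1
    · push_cast
      field_simp
      linear_combination -e2
  rw [shellingAverage, Finset.sum_comm, Finset.sum_congr rfl h,
    Finset.sum_range_sub fun j => 1 / (W.card.choose j : ℚ) * ∑ A ∈ W.powersetCard j, g A]
  simp

theorem shellingAverage_ite_eq_empty {W : Finset V} (hW : W.Nonempty) :
    shellingAverage W (fun _ A => if A = ∅ then 1 else 0) = 1 := by
  have hW' : (W.card : ℚ) ≠ 0 := by exact_mod_cast hW.card_pos.ne'
  have h : ∀ x ∈ W, ∑ j ∈ Finset.range W.card, ∑ A ∈ (W.erase x).powersetCard j,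
      1 / ((W.card : ℚ) * ((W.card - 1).choose j : ℚ)) * (if A = ∅ then 1 else 0) =
        1 / (W.card : ℚ) := by
    intro x _
    rw [Finset.sum_eq_single_of_mem 0 (Finset.mem_range.mpr hW.card_pos)]
    · simp
    · intro j _ hj
      refine Finset.sum_eq_zero fun A hA => ?_
      rw [if_neg, mul_zero]
      rintro rfl
      exact hj (by simpa using (Finset.mem_powersetCard.mp hA).2.symm)
  rw [shellingAverage, Finset.sum_congr rfl h, Finset.sum_const, nsmul_eq_mul,
    mul_one_div_cancel hW']

end Averaging


/-! ### Defects, the mu-vector and tightness. -/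

section Tightness

open Module

section InducedMaps

variable {F : Type*} [Field F] {V : Type*} [Fintype V] [LinearOrder V]

/-- A chain of `Y` bounding in `X` is automatically a cycle of `Y`, so the kernel can be described
without cycles. -/
theorem homologyMap_injective_iff {X Y : PreAbstractSimplicialComplex V} (h : Y ≤ X) (k : ℕ) :
    Function.Injective (homologyMap F h k) ↔
      boundaries F X k ⊓ chains F Y k ≤ boundaries F Y k := by
  rw [← LinearMap.ker_eq_bot, eq_bot_iff]
  constructor
  · rintro hker c ⟨hB, hC⟩
    have hZ : c ∈ cycles F Y k := ⟨hC, (boundaries_le_cycles X k hB).2⟩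
    have hmem : ((boundaries F Y k).submoduleOf (cycles F Y k)).mkQ ⟨c, hZ⟩ ∈
        LinearMap.ker (homologyMap F h k) :=
      LinearMap.mem_ker.mpr ((Submodule.Quotient.mk_eq_zero
        ((boundaries F X k).submoduleOf (cycles F X k))).mpr hB)
    exact (Submodule.Quotient.mk_eq_zero ((boundaries F Y k).submoduleOf (cycles F Y k))).mp
      ((Submodule.mem_bot F).mp (hker hmem))
  · intro hle z hz
    obtain ⟨⟨c, hc⟩, rfl⟩ := Submodule.Quotient.mk_surjective _ z
    have hB : c ∈ boundaries F X k := (Submodule.Quotient.mk_eq_zero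
      ((boundaries F X k).submoduleOf (cycles F X k))).mp (LinearMap.mem_ker.mp hz)
    exact (Submodule.mem_bot F).mpr ((Submodule.Quotient.mk_eq_zero _).mpr (hle ⟨hB, hc.1⟩))

variable (F) in
/-- The dimension of the kernel of `H_k(X[A]) → H_k(X[A ∪ {x}])`. -/
noncomputable def kernelDim (X : PreAbstractSimplicialComplex V) (k : ℕ) (x : V) (A : Finset V) :
    ℚ :=
  (finrank F (boundaries F (induced X (insert x A)) k ⊓
    chains F (induced X A) k : Submodule F (Finset V → F)) : ℚ) -
      finrank F (boundaries F (induced X A) k)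

theorem boundaries_le_inf (X : PreAbstractSimplicialComplex V) (k : ℕ) (x : V) (A : Finset V) :
    boundaries F (induced X A) k ≤
      boundaries F (induced X (insert x A)) k ⊓ chains F (induced X A) k :=
  le_inf (boundaries_mono F (induced_mono X (Finset.subset_insert x A)) k)
    (boundaries_le_chains _ k)

theorem kernelDim_nonneg (X : PreAbstractSimplicialComplex V) (k : ℕ) (x : V) (A : Finset V) :
    0 ≤ kernelDim F X k x A :=
  sub_nonneg.mpr (by exact_mod_cast Submodule.finrank_mono (boundaries_le_inf X k x A))

theorem kernelDim_eq_zero_iff (X : PreAbstractSimplicialComplex V) (k : ℕ) (x : V) (A : Finset V) :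
    kernelDim F X k x A = 0 ↔
      boundaries F (induced X (insert x A)) k ⊓ chains F (induced X A) k ≤
        boundaries F (induced X A) k := by
  rw [kernelDim, sub_eq_zero, Nat.cast_inj]
  constructor
  · intro h
    exact (Submodule.eq_of_le_of_finrank_eq (boundaries_le_inf X k x A) h.symm).ge
  · intro h
    rw [le_antisymm h (boundaries_le_inf X k x A)]

end InducedMaps

section Vertices

variable {V : Type*} [Fintype V] {X : PreAbstractSimplicialComplex V}

theorem mem_vertices {v : V} : v ∈ vertices X ↔ {v} ∈ X := by
  simp [vertices]

theorem subset_vertices {s : Finset V} (hs : s ∈ X) : s ⊆ vertices X := fun v hv =>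
  mem_vertices.mpr ((X.isRelLowerSet_faces hs).2 (Finset.singleton_subset_iff.mpr hv)
    (Finset.singleton_nonempty v))

theorem induced_vertices (X : PreAbstractSimplicialComplex V) : induced X (vertices X) = X :=
  le_antisymm (induced_le X _) fun _ hs => ⟨hs, subset_vertices hs⟩

theorem induced_inter_vertices [DecidableEq V] (X : PreAbstractSimplicialComplex V)
    (A : Finset V) : induced X (A ∩ vertices X) = induced X A :=
  le_antisymm (fun _ hs => ⟨hs.1, hs.2.trans Finset.inter_subset_left⟩)
    fun _ hs => ⟨hs.1, Finset.subset_inter hs.2 (subset_vertices hs.1)⟩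

variable [LinearOrder V]

theorem IsNeighbourly.pair_mem (hX : IsNeighbourly X 2) {u v : V} (hu : {u} ∈ X) (hv : {v} ∈ X)
    (huv : u ≠ v) : {u, v} ∈ X :=
  hX {u, v} (by simp [Finset.insert_subset_iff, mem_vertices, hu, hv]) (Finset.card_pair huv)
    (by simp)

theorem IsNeighbourly.vertices_link (hX : IsNeighbourly X 2) {x : V} (hx : x ∈ vertices X) :
    vertices (link X x) = (vertices X).erase x := by
  ext v
  rw [mem_vertices, Finset.mem_erase, mem_vertices]
  constructor
  · rintro ⟨h1, h2, -⟩
    exact ⟨fun h => h2 (by simp [h]), h1⟩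
  · rintro ⟨hne, hv⟩
    exact ⟨hv, by simpa using hne.symm, hX.pair_mem (mem_vertices.mp hx) hv hne.symm⟩

end Vertices

variable {F : Type*} [Field F] {V : Type*} [Fintype V] [LinearOrder V]
  {X : PreAbstractSimplicialComplex V}

variable (F) in
/-- The dimension of the relative homology `H_k(X[A ∪ {x}], X[A])`, in terms of the link of `x`. -/
noncomputable def relativeBetti (X : PreAbstractSimplicialComplex V) :
    ℕ → V → Finset V → ℚ
  | 0, _, A => if A = ∅ then 1 else 0
  | k + 1, x, A => (if k = 0 ∧ A = ∅ then 1 else 0) + reducedBetti F (induced (link X x) A) k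

variable (F) in
/-- The defect in the Morse inequality for `H_k` at the step from `X[A]` to `X[A ∪ {x}]`. -/
noncomputable def morseDefect (X : PreAbstractSimplicialComplex V) : ℕ → V → Finset V → ℚ
  | 0, x, A => kernelDim F X 0 x A
  | k + 1, x, A => kernelDim F X k x A + kernelDim F X (k + 1) x A

/-- This is the dimension count of the long exact sequence of the pair. Expressing every Betti
number through ranks of chains and boundaries leaves a linear identity. -/
theorem betti_insert_sub_betti (hX : IsNeighbourly X 2) (k : ℕ) {x : V} (hx : x ∈ vertices X)
    {A : Finset V} (hA : A ⊆ (vertices X).erase x) :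
    (betti F (induced X (insert x A)) k : ℚ) - betti F (induced X A) k =
      relativeBetti F X k x A - morseDefect F X k x A := by
  have hxA : x ∉ A := fun h => by simpa using hA h
  have hedge : ∀ v ∈ A, {v} ∈ X ∧ {x, v} ∈ X := by
    intro v hv
    have h := Finset.mem_erase.mp (hA hv)
    exact ⟨mem_vertices.mp h.2,
      hX.pair_mem (mem_vertices.mp hx) (mem_vertices.mp h.2) h.1.symm⟩
  have hB0 := congrArg (Nat.cast (R := ℚ)) (finrank_boundaries_zero (F := F) hxA hedge)
  push_cast at hB0
  -- Degrees 0 and 1 are separate because there the empty face of the link enters the count.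
  rcases k with - | - | k
  · have h1 := congrArg (Nat.cast (R := ℚ)) (betti_zero_add (F := F) (induced X (insert x A)))
    have h2 := congrArg (Nat.cast (R := ℚ)) (betti_zero_add (F := F) (induced X A))
    have h3 := congrArg (Nat.cast (R := ℚ))
      (finrank_chains_zero (F := F) (mem_vertices.mp hx) hxA)
    push_cast at h1 h2 h3
    simp only [relativeBetti, morseDefect, kernelDim]
    split_ifs at hB0 ⊢ <;> linarith
  · have h1 := congrArg (Nat.cast (R := ℚ)) (betti_succ_add (F := F) (induced X (insert x A)) 0)
    have h2 := congrArg (Nat.cast (R := ℚ)) (betti_succ_add (F := F) (induced X A) 0)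
    have h3 := congrArg (Nat.cast (R := ℚ)) (finrank_chains_succ (F := F) (X := X) hxA 0)
    have h4 := congrArg (Nat.cast (R := ℚ)) (finrank_boundaries_succ (F := F) (X := X) hxA 0)
    have h5 := congrArg (Nat.cast (R := ℚ)) (betti_zero_add (F := F) (induced (link X x) A))
    push_cast at h1 h2 h3 h4 h5
    simp only [relativeBetti, morseDefect, kernelDim, reducedBetti, true_and, if_true]
    push_cast
    split_ifs at hB0 ⊢ <;> linarith
  · have h1 := congrArg (Nat.cast (R := ℚ))
      (betti_succ_add (F := F) (induced X (insert x A)) (k + 1))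
    have h2 := congrArg (Nat.cast (R := ℚ)) (betti_succ_add (F := F) (induced X A) (k + 1))
    have h3 := congrArg (Nat.cast (R := ℚ)) (finrank_chains_succ (F := F) (X := X) hxA (k + 1))
    have h4 := congrArg (Nat.cast (R := ℚ)) (finrank_boundaries_succ (F := F) (X := X) hxA (k + 1))
    have h5 := congrArg (Nat.cast (R := ℚ)) (finrank_boundaries_succ (F := F) (X := X) hxA k)
    have h6 := congrArg (Nat.cast (R := ℚ)) (betti_succ_add (F := F) (induced (link X x) A) k)
    push_cast at h1 h2 h3 h4 h5 h6
    simp only [relativeBetti, morseDefect, kernelDim, reducedBetti, Nat.add_eq_zero_iff,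
      one_ne_zero, and_false, false_and, if_false]
    push_cast
    linarith

theorem betti_induced_empty (X : PreAbstractSimplicialComplex V) (k : ℕ) :
    betti F (induced X ∅) k = 0 := by
  have h := betti_add_finrank_boundaries (F := F) (induced X ∅) k
  rw [cycles, chains_induced_empty, bot_inf_eq, finrank_bot] at h
  lia

/-- Each link has `m - 1` vertices, so `1 / m` times the weights of `sigma` are the ordering
weights. The Kronecker delta is the average of the indicator of `A = ∅`, since every ordering has
one first vertex. -/
theorem mu_eq_shellingAverage (hX : IsNeighbourly X 2) (hne : (vertices X).Nonempty) (k : ℕ) :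
    mu F X k = shellingAverage (vertices X) (relativeBetti F X k) := by
  cases k with
  | zero => exact (shellingAverage_ite_eq_empty hne).symm
  | succ k =>
    have hsplit : relativeBetti F X (k + 1) = fun x A =>
        (if k = 0 ∧ A = ∅ then (1 : ℚ) else 0) + reducedBetti F (induced (link X x) A) k := rfl
    rw [hsplit, shellingAverage_add, mu]
    congr 1
    · rcases eq_or_ne k 0 with rfl | hk
      · simp [shellingAverage_ite_eq_empty hne]
      · simp [hk, shellingAverage]
    · rw [shellingAverage, Finset.mul_sum]
      refine Finset.sum_congr rfl fun x hx => ?_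
      rw [sigma, hX.vertices_link hx, Finset.card_erase_of_mem hx,
        Nat.sub_add_cancel hne.card_pos, Finset.mul_sum]
      refine Finset.sum_congr rfl fun j _ => ?_
      rw [Finset.mul_sum, Finset.mul_sum]
      refine Finset.sum_congr rfl fun A _ => ?_
      rw [← mul_assoc, one_div_mul_one_div]

theorem mu_sub_betti (hX : IsNeighbourly X 2) (hne : (vertices X).Nonempty) (k : ℕ) :
    mu F X k - betti F X k = shellingAverage (vertices X) (morseDefect F X k) := by
  have h := shellingAverage_telescope (vertices X) fun A => (betti F (induced X A) k : ℚ)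
  rw [shellingAverage_congr fun x hx A hA => betti_insert_sub_betti hX k hx hA,
    shellingAverage_sub, ← mu_eq_shellingAverage hX hne, induced_vertices, betti_induced_empty,
    Nat.cast_zero, sub_zero] at h
  rw [← h, sub_sub_cancel]

theorem morseDefect_nonneg (X : PreAbstractSimplicialComplex V) (k : ℕ) (x : V) (A : Finset V) :
    0 ≤ morseDefect F X k x A := by
  cases k with
  | zero => exact kernelDim_nonneg X 0 x A
  | succ k => exact add_nonneg (kernelDim_nonneg X k x A) (kernelDim_nonneg X (k + 1) x A)

theorem kernelDim_le_morseDefect (X : PreAbstractSimplicialComplex V) (k : ℕ) (x : V)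
    (A : Finset V) : kernelDim F X k x A ≤ morseDefect F X k x A := by
  cases k with
  | zero => exact le_rfl
  | succ k => exact le_add_of_nonneg_left (kernelDim_nonneg X k x A)

/-- The injective map from `X[A]` to `X` factors through `X[A ∪ {x}]`. -/
theorem IsTight.kernelDim_eq_zero {d : ℕ} (h : IsTight F X d) {k : ℕ} (hk : k ≤ d) (x : V)
    (A : Finset V) : kernelDim F X k x A = 0 := by
  rw [kernelDim_eq_zero_iff]
  refine le_trans ?_ ((homologyMap_injective_iff (induced_le X A) k).mp (h.2 A k hk))
  exact inf_le_inf_right _ (boundaries_mono F (induced_le X _) k)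

theorem homologyMap_injective_of_kernelDim {k : ℕ}
    (h : ∀ x ∈ vertices X, ∀ A ⊆ (vertices X).erase x, kernelDim F X k x A = 0) (A : Finset V) :
    Function.Injective (homologyMap F (induced_le X A) k) := by
  -- Induction on the number of vertices missing from `A`: one-vertex inclusions are composed until
  -- all of `X` is reached.
  have key : ∀ n, ∀ A ⊆ vertices X, (vertices X \ A).card = n →
      boundaries F X k ⊓ chains F (induced X A) k ≤ boundaries F (induced X A) k := by
    intro n
    induction n with
    | zero =>
      intro A hA hcard
      have hA' : A = vertices X :=
        hA.antisymm (Finset.sdiff_eq_empty_iff_subset.mp (Finset.card_eq_zero.mp hcard))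
      rw [hA', induced_vertices]
      exact inf_le_left
    | succ n ih =>
      intro A hA hcard
      obtain ⟨x, hx⟩ := Finset.card_pos.mp (by lia : 0 < (vertices X \ A).card)
      have hx' := Finset.mem_sdiff.mp hx
      have h1 := ih (insert x A) (Finset.insert_subset hx'.1 hA) (by
        rw [Finset.sdiff_insert, Finset.card_erase_of_mem hx, hcard, Nat.add_sub_cancel])
      have h2 := (kernelDim_eq_zero_iff X k x A).mp
        (h x hx'.1 A (Finset.subset_erase.mpr ⟨hA, hx'.2⟩))
      rintro c ⟨hB, hC⟩
      exact h2 ⟨h1 ⟨hB, chains_mono F (induced_mono X (Finset.subset_insert x A)) k hC⟩, hC⟩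
  rw [homologyMap_injective_iff, ← induced_inter_vertices X A]
  exact key _ _ Finset.inter_subset_right rfl

theorem IsNeighbourly.isConnected (hX : IsNeighbourly X 2) (hne : (vertices X).Nonempty) :
    IsConnected X := by
  obtain ⟨x, hx⟩ := hne
  have : Nonempty {v : V // ({v} : Finset V) ∈ X} := ⟨⟨x, mem_vertices.mp hx⟩⟩
  refine SimpleGraph.Connected.mk fun u v => ?_
  rcases eq_or_ne u v with rfl | huv
  · exact SimpleGraph.Reachable.refl u
  · exact SimpleGraph.Adj.reachable
      ⟨huv, hX.pair_mem u.2 v.2 fun h => huv (Subtype.ext h)⟩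

theorem single_sub_single_mem_boundaries {u v : V} (huv : u ≠ v) (h : {u, v} ∈ X) :
    (Pi.single {u} 1 - Pi.single {v} 1 : Finset V → F) ∈ boundaries F X 0 := by
  wlog hlt : u < v generalizing u v
  · rw [← neg_sub]
    exact neg_mem (this huv.symm (by rwa [Finset.pair_comm])
      (lt_of_le_of_ne (not_lt.mp hlt) huv.symm))
  have hc : (Pi.single {u, v} 1 : Finset V → F) ∈ chains F X 1 := by
    intro s hs
    refine Pi.single_eq_of_ne (fun h' => hs ?_) _
    subst h'
    exact ⟨h, Finset.card_pair huv⟩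
  -- For `u < v` the boundary of the edge is `v - u`, hence the sign.
  refine ⟨-Pi.single {u, v} 1, neg_mem hc, ?_⟩
  rw [map_neg, boundary_eq_augmentedBoundary hc, augmentedBoundary_apply]
  simp only [contraction_single, Finset.sum_ite_mem, Finset.univ_inter]
  rw [Finset.sum_pair huv, Finset.pair_comm, Finset.erase_insert (by simpa using huv.symm),
    Finset.pair_comm, Finset.erase_insert (by simpa using huv)]
  simp [deletionSign, Finset.filter_insert, Finset.filter_singleton, hlt, hlt.not_gt]
  abel

theorem IsConnected.single_sub_single_mem_boundaries (hX : IsConnected X) {u v : V}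
    (hu : {u} ∈ X) (hv : {v} ∈ X) :
    (Pi.single {u} 1 - Pi.single {v} 1 : Finset V → F) ∈ boundaries F X 0 := by
  obtain ⟨p⟩ := hX.preconnected ⟨u, hu⟩ ⟨v, hv⟩
  suffices h : ∀ a b : {v : V // ({v} : Finset V) ∈ X}, (edgeGraph X).Walk a b →
      (Pi.single {a.1} 1 - Pi.single {b.1} 1 : Finset V → F) ∈ boundaries F X 0 from h _ _ p
  intro a b q
  induction q with
  | nil => simp
  | cons h _ ih =>
    rw [← sub_add_sub_cancel]
    exact add_mem (SimplicialTightness.single_sub_single_mem_boundaries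
      (fun h' => h.1 (Subtype.ext h')) h.2) ih

theorem IsTight.isNeighbourly {d : ℕ} (hX : IsTight F X d) : IsNeighbourly X 2 := by
  intro A hA hcard _
  obtain ⟨u, v, huv, rfl⟩ := Finset.card_eq_two.mp hcard
  have hu : {u} ∈ X := mem_vertices.mp (hA (by simp))
  have hv : {v} ∈ X := mem_vertices.mp (hA (by simp))
  by_contra hmem
  -- Without the edge, the subcomplex on `u` and `v` has no nonzero boundaries in degree 0.
  have hchains : chains F (induced X {u, v}) 1 = ⊥ := by
    rw [eq_bot_iff]
    intro c hc
    rw [Submodule.mem_bot]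
    ext s
    refine hc s fun h => hmem ?_
    rw [← Finset.eq_of_subset_of_card_le h.1.2 (by rw [hcard, h.2])]
    exact h.1.1
  have hle := (homologyMap_injective_iff (induced_le X {u, v}) 0).mp (hX.2 _ 0 (Nat.zero_le d))
  have hsingle : ∀ w, {w} ∈ X → w ∈ ({u, v} : Finset V) →
      (Pi.single {w} 1 : Finset V → F) ∈ chains F (induced X {u, v}) 0 := by
    intro w hw hmem' s hs
    refine Pi.single_eq_of_ne (fun h => hs ?_) _
    subst h
    exact ⟨⟨hw, by simpa using hmem'⟩, by simp⟩
  have h := hle ⟨hX.1.single_sub_single_mem_boundaries hu hv,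
    sub_mem (hsingle u hu (by simp)) (hsingle v hv (by simp))⟩
  rw [boundaries, zero_add, hchains, Submodule.map_bot, Submodule.mem_bot] at h
  have h' := congrFun h {u}
  simp [huv] at h'

end Tightness

end SimplicialTightness

theorem theorem2p10 (F : Type*) [Field F] {V : Type*} [Fintype V] [LinearOrder V]
    (X : PreAbstractSimplicialComplex V) (d : ℕ) (hd : SimplicialTightness.HasDimension X d) :
    SimplicialTightness.IsTight F X d ↔
      SimplicialTightness.IsNeighbourly X 2 ∧
        ∀ i ≤ d, SimplicialTightness.mu F X i = (SimplicialTightness.betti F X i : ℚ) := by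
  open SimplicialTightness in
  obtain ⟨⟨s, hs, -⟩, -⟩ := hd
  have hne : (vertices X).Nonempty := (X.isRelLowerSet_faces hs).1.mono (subset_vertices hs)
  constructor
  · intro h
    refine ⟨h.isNeighbourly, fun i hi => sub_eq_zero.mp ?_⟩
    rw [mu_sub_betti h.isNeighbourly hne]
    have hzero : morseDefect F X i = fun _ _ => 0 := by
      funext x A
      cases i with
      | zero => exact h.kernelDim_eq_zero hi x A
      | succ i =>
        rw [morseDefect, h.kernelDim_eq_zero hi, h.kernelDim_eq_zero (by lia), add_zero]
    rw [hzero]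
    simp [shellingAverage]
  · rintro ⟨hX, hmu⟩
    refine ⟨hX.isConnected hne, fun A j hj => ?_⟩
    refine homologyMap_injective_of_kernelDim (fun x hx B hB => ?_) A
    refine le_antisymm ?_ (kernelDim_nonneg X j x B)
    -- Equality in degree `j` makes the average defect zero, hence every defect, and the defect
    -- bounds the kernel dimension in degree `j`.
    rw [← eq_zero_of_shellingAverage_eq_zero (fun y _ C _ => morseDefect_nonneg (F := F) X j y C)
      (by rw [← mu_sub_betti hX hne, hmu j hj, sub_self]) x hx B hB]
    exact kernelDim_le_morseDefect X j x B
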